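/- Let $k\ge 1$ be an integer and let $\mathscr P$ be the set of Borel probability measures on $\mathbf R^k$, endowed with the topology of weak convergence. Let $\mathsf D\subseteq\mathscr P$ be the set of all $F\in\mathscr P$ for which there exist a measure $G\in\mathscr P$, none of whose one-dimensional marginals is a point mass, and vectors $\alpha_n,\beta_n\in\mathbf R^k$ ($n\ge 1$) with $\alpha_{n,j}>0$ for all $n\ge 1$ and $1\le j\le k$, such that the following holds: if $X_1,X_2,\dots$ are i.i.d. random vectors with law $F$ and $M_n=\max\{X_1,\dots,X_n\}$ is the componentwise maximum, then the laws of $$(\alpha_{n,1}M_{n,1}+\beta_{n,1},\,\dots,\,\alpha_{n,k}M_{n,k}+\beta_{n,k})$$ converge weakly to $G$ as $n\to\infty$. Then $\mathsf D$ is dense in $\mathscr P$ and of the first Baire category in $\mathscr P$, i.e. it is contained in a countable union of closed subsets of $\mathscr P$ with empty interior. -/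

import Mathlib

open MeasureTheory Filter Topology

noncomputable section

namespace ExtremeValue

/-- The componentwise maximum of `n + 1` vectors of `ℝ^k`. The supremum is taken in the product
order of `Fin k → ℝ`. -/
def vecMax {k : ℕ} (n : ℕ) (x : Fin (n + 1) → Fin k → ℝ) : Fin k → ℝ :=
  Finset.univ.sup' Finset.univ_nonempty x

theorem measurable_vecMax {k : ℕ} (n : ℕ) :
    Measurable (vecMax (k := k) n) := by
  refine measurable_pi_iff.2 fun j => ?_
  have h : Measurable (Finset.univ.sup' Finset.univ_nonempty
      (fun (i : Fin (n + 1)) (x : Fin (n + 1) → Fin k → ℝ) => x i j)) :=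
    Finset.measurable_sup' _ fun i _ => by fun_prop
  convert h using 1
  ext x
  simp [vecMax, Finset.sup'_apply]

/-- The law of `max {X₁, …, Xₙ₊₁}`, where `X₁, …, Xₙ₊₁` are independent random vectors of `ℝ^k`
with common law `F`. Their joint law is the product measure `F ⊗ ⋯ ⊗ F`. -/
def maxLaw {k : ℕ} (F : ProbabilityMeasure (Fin k → ℝ)) (n : ℕ) :
    ProbabilityMeasure (Fin k → ℝ) :=
  (ProbabilityMeasure.pi fun _ : Fin (n + 1) => F).map (measurable_vecMax n).aemeasurable

/-- The map of `ℝ^k` that is affine on each component,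
`(x₁, …, xₖ) ↦ (α₁ x₁ + β₁, …, αₖ xₖ + βₖ)`. -/
def affineMap {k : ℕ} (α β : Fin k → ℝ) (x : Fin k → ℝ) : Fin k → ℝ :=
  fun j => α j * x j + β j

theorem measurable_affineMap {k : ℕ} (α β : Fin k → ℝ) : Measurable (affineMap α β) := by
  unfold affineMap
  fun_prop

/-- Every one-dimensional marginal of `G` is nondegenerate, i.e. is not a point mass. -/
def NondegenerateMarginals {k : ℕ} (G : ProbabilityMeasure (Fin k → ℝ)) : Prop :=
  ∀ (j : Fin k) (c : ℝ),
    (G : Measure (Fin k → ℝ)).map (fun x => x j) ≠ Measure.dirac c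

/-- `F` belongs to the domain of attraction of `G`: `G` has nondegenerate marginals and, for
suitable componentwise affine maps with positive slopes, the laws of the normalised componentwise
maxima of i.i.d. vectors with law `F` converge weakly to `G`. The topology of
`ProbabilityMeasure` is that of weak convergence. -/
def InDomainOfAttraction {k : ℕ} (F G : ProbabilityMeasure (Fin k → ℝ)) : Prop :=
  NondegenerateMarginals G ∧
    ∃ α β : ℕ → Fin k → ℝ, (∀ n j, 0 < α n j) ∧
      Tendsto (fun n => (maxLaw F n).map (measurable_affineMap (α n) (β n)).aemeasurable)
        atTop (𝓝 G)

/-- The maximum domain of attraction: the laws on `ℝ^k` that belong to the domain of attraction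
of some law on `ℝ^k` (a multivariate extreme value distribution). -/
def maxDomain (k : ℕ) : Set (ProbabilityMeasure (Fin k → ℝ)) :=
  {F | ∃ G : ProbabilityMeasure (Fin k → ℝ), InDomainOfAttraction F G}

end ExtremeValue

end

open MeasureTheory Filter Topology

noncomputable section

namespace ExtremeValue

/-! ### Weak convergence in terms of real-valued measures of sets -/

section Portmanteau

variable {Ω ι : Type*} [MeasurableSpace Ω] [TopologicalSpace Ω] [HasOuterApproxClosed Ω]
  [OpensMeasurableSpace Ω] {L : Filter ι} {ν : ι → ProbabilityMeasure Ω}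
  {μ : ProbabilityMeasure Ω}

/-! Both claims rest on changing a law only far out in its upper tail: this is a small change for
weak convergence, yet it decides how late maxima behave. Take `X` with law `F` and an independent
`V`, the negative of an exponential variable. Keep `X`, truncated above at `m`, unless `V` is within
`1 / (m + 1)` of `0`; then use the diagonal point `ψ V` instead. The new law tends to `F` as `m →
∞`, whatever `ψ` is (`tendsto_spliceLaw`). If `ψ` is monotone and at least `m` near `0`, a late
maximum is, with high probability, `ψ` of the maximum of the `V`s, and the maximum of `n + 1` of
them is distributed as `V / (n + 1)` (`le_maxLaw_spliceLaw`).

Density: with `ψ` a translation, the spliced law is attracted to the law of `(V, …, V)`.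

Category: with `ψ` a step function, one component of some late maximum is nearly a two-point law
with weights `p`, `1 - p`. Hence the laws for which this happens along arbitrarily late maxima, ever
more precisely, contain a dense `G_δ`. Being nearly two-point is affine invariant, so any
nondegenerate limit of normalised maxima has atoms of masses `p` and `1 - p`
(`exists_atoms_of_tendsto`). A generic `F` has this property for both `p = 1/2` and `p = 1/3`, and
no single limit can comply. -/

theorem eventually_lt_measureReal_of_isOpen (h : Tendsto ν L (𝓝 μ)) {O : Set Ω} (hO : IsOpen O)
    {c : ℝ} (hc : c < (μ : Measure Ω).real O) :
    ∀ᶠ i in L, c < (ν i : Measure Ω).real O := by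
  rcases lt_or_ge c 0 with h0 | h0
  · exact Eventually.of_forall fun i => h0.trans_le measureReal_nonneg
  · have h1 : ENNReal.ofReal c < (μ : Measure Ω) O := by
      rwa [ENNReal.ofReal_lt_iff_lt_toReal h0 (measure_ne_top _ _)]
    filter_upwards [eventually_lt_of_lt_liminf
      (h1.trans_le (ProbabilityMeasure.le_liminf_measure_open_of_tendsto h hO))] with i hi
    rwa [ENNReal.ofReal_lt_iff_lt_toReal h0 (measure_ne_top _ _)] at hi

theorem le_measureReal_of_isClosed (h : Tendsto ν L (𝓝 μ)) {C : Set Ω} (hC : IsClosed C)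
    {c : ℝ} (hc : ∃ᶠ i in L, c ≤ (ν i : Measure Ω).real C) :
    c ≤ (μ : Measure Ω).real C := by
  by_contra! hlt
  have h1 : 1 - c < (μ : Measure Ω).real Cᶜ := by
    rw [probReal_compl_eq_one_sub hC.measurableSet]; linarith
  obtain ⟨i, hi, hi'⟩ :=
    (hc.and_eventually (eventually_lt_measureReal_of_isOpen h hC.isOpen_compl h1)).exists
  rw [probReal_compl_eq_one_sub hC.measurableSet] at hi'
  linarith

end Portmanteau

/-! ### Laws on the line that are close to a two-point law -/

/-- Up to `ε`, the law `ν` gives mass `p` to a point `a` and mass `1 - p` to a point `b > a`; the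
masses are those of intervals that are short in comparison with `b - a`. -/
def IsNearTwoPoint (p ε : ℝ) (ν : ProbabilityMeasure ℝ) : Prop :=
  ∃ a b : ℝ, a < b ∧ p - ε < (ν : Measure ℝ).real (Metric.ball a (ε * (b - a))) ∧
    1 - p - ε < (ν : Measure ℝ).real (Metric.ball b (ε * (b - a)))

theorem isOpen_setOf_isNearTwoPoint (p ε : ℝ) : IsOpen {ν | IsNearTwoPoint p ε ν} := by
  rw [isOpen_iff_mem_nhds]
  rintro ν ⟨a, b, hab, ha, hb⟩
  filter_upwards [eventually_lt_measureReal_of_isOpen tendsto_id Metric.isOpen_ball ha,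
    eventually_lt_measureReal_of_isOpen tendsto_id Metric.isOpen_ball hb] with ν' h1 h2
  exact ⟨a, b, hab, h1, h2⟩

/-- The radii are proportional to `b - a`, so an increasing affine map carries the two balls to the
balls required for the images of `a` and `b`. -/
theorem IsNearTwoPoint.map_affine {p ε : ℝ} {ν : ProbabilityMeasure ℝ}
    (h : IsNearTwoPoint p ε ν) {α : ℝ} (hα : 0 < α) (β : ℝ)
    (hm : AEMeasurable (fun x : ℝ => α * x + β) (ν : Measure ℝ)) :
    IsNearTwoPoint p ε (ν.map hm) := by
  obtain ⟨a, b, hab, ha, hb⟩ := h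
  have key : ∀ c, ((ν.map hm : ProbabilityMeasure ℝ) : Measure ℝ).real
      (Metric.ball (α * c + β) (ε * ((α * b + β) - (α * a + β)))) =
      (ν : Measure ℝ).real (Metric.ball c (ε * (b - a))) := by
    intro c
    rw [ProbabilityMeasure.toMeasure_map, measureReal_def, measureReal_def,
      Measure.map_apply_of_aemeasurable hm Metric.isOpen_ball.measurableSet]
    congr 2
    ext x
    simp only [Set.mem_preimage, Metric.mem_ball, Real.dist_eq]
    rw [show α * x + β - (α * c + β) = α * (x - c) by ring, abs_mul, abs_of_pos hα,
      show ε * (α * b + β - (α * a + β)) = α * (ε * (b - a)) by ring]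
    exact mul_lt_mul_iff_right₀ hα
  refine ⟨α * a + β, α * b + β, by gcongr, ?_, ?_⟩ <;> rwa [key]

theorem eq_dirac_of_measureReal_singleton {Ω : Type*} [MeasurableSpace Ω]
    [MeasurableSingletonClass Ω] {μ : Measure Ω} [IsProbabilityMeasure μ] {c : Ω}
    (h : 1 ≤ μ.real {c}) : μ = Measure.dirac c := by
  have h1 : μ {c} = 1 := le_antisymm prob_le_one (by
    rw [← ENNReal.ofReal_one]
    exact (ENNReal.ofReal_le_iff_le_toReal (measure_ne_top _ _)).2 h)
  have h2 : ∀ᵐ x ∂μ, x = c := by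
    have : ∀ᵐ x ∂μ, x ∈ ({c} : Set Ω) :=
      (prob_compl_eq_zero_iff (measurableSet_singleton c)).2 h1
    exact this
  have h3 := Measure.map_congr (β := Ω) (mβ := inferInstance) (μ := μ) (f := id) (g := fun _ => c) h2
  simpa [Measure.map_const] using h3

theorem le_measureReal_singleton {μ : Measure ℝ} [IsFiniteMeasure μ] {c A : ℝ}
    (h : ∀ ε > 0, c ≤ μ.real (Metric.closedBall A ε)) : c ≤ μ.real {A} := by
  have hinter : ⋂ n : ℕ, Metric.closedBall A (1 / ((n : ℝ) + 1)) = {A} := by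
    ext x
    simp only [Set.mem_iInter, Metric.mem_closedBall, Set.mem_singleton_iff]
    refine ⟨fun hx => dist_le_zero.1 (ge_of_tendsto' tendsto_one_div_add_atTop_nhds_zero_nat hx),
      fun hx n => by rw [hx, dist_self]; positivity⟩
  have ht : Tendsto (fun n : ℕ => μ (Metric.closedBall A (1 / ((n : ℝ) + 1)))) atTop
      (𝓝 (μ {A})) := by
    rw [← hinter]
    refine tendsto_measure_iInter_atTop
      (fun n => Metric.isClosed_closedBall.measurableSet.nullMeasurableSet) ?_
      ⟨0, measure_ne_top _ _⟩
    intro m n hmn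
    exact Metric.closedBall_subset_closedBall (one_div_le_one_div_of_le (by positivity) (by gcongr))
  exact ge_of_tendsto' ((ENNReal.tendsto_toReal (measure_ne_top _ _)).comp ht)
    fun n => h _ (by positivity)

theorem exists_measureReal_ball_gt (μ : Measure ℝ) [IsProbabilityMeasure μ] {c : ℝ} (hc : c < 1) :
    ∃ R : ℝ, 0 < R ∧ c < μ.real (Metric.ball 0 R) := by
  have ht : Tendsto (fun n : ℕ => μ (Metric.ball (0 : ℝ) n)) atTop (𝓝 (μ Set.univ)) := by
    rw [← Metric.iUnion_ball_nat (0 : ℝ)]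
    refine tendsto_measure_iUnion_atTop fun m n hmn => Metric.ball_subset_ball (by gcongr)
  have h2 := (ENNReal.tendsto_toReal (measure_ne_top _ _)).comp ht
  rw [measure_univ, ENNReal.toReal_one] at h2
  obtain ⟨n, hn, hn'⟩ := ((h2.eventually (lt_mem_nhds hc)).and (eventually_gt_atTop 0)).exists
  exact ⟨n, by exact_mod_cast hn', hn⟩

theorem inter_nonempty_of_one_lt_measureReal_add {Ω : Type*} [MeasurableSpace Ω] {μ : Measure Ω}
    [IsProbabilityMeasure μ] {s t : Set Ω} (ht : MeasurableSet t)
    (h : 1 < μ.real s + μ.real t) : (s ∩ t).Nonempty := by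
  by_contra hne
  rw [Set.not_nonempty_iff_eq_empty, ← Set.disjoint_iff_inter_eq_empty] at hne
  have := measureReal_union (μ := μ) hne ht
  have h1 : μ.real (s ∪ t) ≤ 1 := measureReal_le_one
  linarith

/-- A nondegenerate weak limit of laws that are ever closer to two-point laws with weights `p` and
`1 - p` has atoms with these weights. -/
theorem exists_atoms_of_tendsto {ν : ℕ → ProbabilityMeasure ℝ} {μ : ProbabilityMeasure ℝ}
    (hν : Tendsto ν atTop (𝓝 μ)) (hμ : ∀ c, (μ : Measure ℝ) ≠ Measure.dirac c)
    {p : ℝ} (hp0 : 0 < p) (hp1 : p < 1) {ε : ℕ → ℝ} (hε : Tendsto ε atTop (𝓝 0))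
    (h : ∀ l, IsNearTwoPoint p (ε l) (ν l)) :
    ∃ A B : ℝ, A < B ∧ p ≤ (μ : Measure ℝ).real {A} ∧ 1 - p ≤ (μ : Measure ℝ).real {B} := by
  choose a b hab ha hb using h
  set q := min p (1 - p) with hq
  have hq0 : 0 < q := lt_min hp0 (by linarith)
  obtain ⟨R, hR0, hR⟩ := exists_measureReal_ball_gt (μ : Measure ℝ) (c := 1 - q / 2) (by linarith)
  -- Tightness: each ball has mass above `q / 2`, so it meets `ball 0 R`. With `ε l < 1/4` this
  -- forces `b l - a l < 4 * R`; the bound `5 * R` is generous.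
  have hbd : ∀ᶠ l in atTop, |a l| < 5 * R ∧ |b l| < 5 * R := by
    filter_upwards [eventually_lt_measureReal_of_isOpen hν Metric.isOpen_ball hR,
      hε.eventually (gt_mem_nhds (show (0 : ℝ) < q / 2 by linarith)),
      hε.eventually (gt_mem_nhds (show (0 : ℝ) < 1 / 4 by norm_num))] with l h1 h2 h3
    have hqp : q ≤ p := min_le_left _ _
    have hqp' : q ≤ 1 - p := min_le_right _ _
    obtain ⟨x, hx1, hx2⟩ := inter_nonempty_of_one_lt_measureReal_add (μ := (ν l : Measure ℝ))
      (s := Metric.ball 0 R) (t := Metric.ball (a l) (ε l * (b l - a l)))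
      Metric.isOpen_ball.measurableSet (by linarith [ha l])
    obtain ⟨y, hy1, hy2⟩ := inter_nonempty_of_one_lt_measureReal_add (μ := (ν l : Measure ℝ))
      (s := Metric.ball 0 R) (t := Metric.ball (b l) (ε l * (b l - a l)))
      Metric.isOpen_ball.measurableSet (by linarith [hb l])
    simp only [Metric.mem_ball, Real.dist_eq, sub_zero, abs_lt] at hx1 hx2 hy1 hy2
    have h4 : ε l * (b l - a l) ≤ 1 / 4 * (b l - a l) :=
      mul_le_mul_of_nonneg_right h3.le (by linarith [hab l])
    refine ⟨abs_lt.2 ⟨?_, ?_⟩, abs_lt.2 ⟨?_, ?_⟩⟩ <;> linarith [hab l]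
  obtain ⟨⟨A, B⟩, -, φ, hφ, hlim⟩ := tendsto_subseq_of_frequently_bounded
    (s := Metric.ball (0 : ℝ × ℝ) (5 * R)) Metric.isBounded_ball (x := fun l => (a l, b l))
    (by
      refine Eventually.frequently (hbd.mono fun l hl => ?_)
      simp only [Metric.mem_ball, dist_zero_right, Prod.norm_def, Real.norm_eq_abs]
      exact max_lt hl.1 hl.2)
  have hA : Tendsto (fun l => a (φ l)) atTop (𝓝 A) := (continuous_fst.tendsto _).comp hlim
  have hB : Tendsto (fun l => b (φ l)) atTop (𝓝 B) := (continuous_snd.tendsto _).comp hlim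
  have hεφ : Tendsto (fun l => ε (φ l)) atTop (𝓝 0) := hε.comp hφ.tendsto_atTop
  have hνφ : Tendsto (fun l => ν (φ l)) atTop (𝓝 μ) := hν.comp hφ.tendsto_atTop
  have hδ : Tendsto (fun l => ε (φ l) * (b (φ l) - a (φ l))) atTop (𝓝 0) := by
    simpa using hεφ.mul (hB.sub hA)
  have hsub : ∀ {c : ℕ → ℝ} {C : ℝ}, Tendsto c atTop (𝓝 C) → ∀ η > 0, ∀ᶠ l in atTop,
      Metric.ball (c l) (ε (φ l) * (b (φ l) - a (φ l))) ⊆ Metric.closedBall C η := by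
    intro c C hc η hη
    filter_upwards [hδ.eventually (gt_mem_nhds (half_pos hη)),
      Metric.tendsto_nhds.1 hc _ (half_pos hη)] with l h1 h2
    exact (Metric.ball_subset_ball' (by linarith)).trans Metric.ball_subset_closedBall
  have hatom : ∀ {c : ℕ → ℝ} {C r : ℝ}, Tendsto c atTop (𝓝 C) →
      (∀ l, r - ε (φ l) <
        (ν (φ l) : Measure ℝ).real (Metric.ball (c l) (ε (φ l) * (b (φ l) - a (φ l))))) →
      r ≤ (μ : Measure ℝ).real {C} := by
    intro c C r hc hr
    refine le_measureReal_singleton fun η hη => le_of_forall_pos_sub_le fun e he => ?_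
    refine le_measureReal_of_isClosed hνφ Metric.isClosed_closedBall (Eventually.frequently ?_)
    filter_upwards [hsub hc η hη, hεφ.eventually (gt_mem_nhds he)] with l h1 h2
    exact (by linarith [hr l] : r - e ≤ _).trans (measureReal_mono h1)
  refine ⟨A, B, lt_of_le_of_ne (le_of_tendsto_of_tendsto' hA hB fun l => (hab _).le) ?_,
    hatom hA fun l => ha _, hatom hB fun l => hb _⟩
  -- If the centres merged, two disjoint balls of total mass nearly `1` would shrink to one point,
  -- and the limit would be degenerate.
  rintro rfl
  refine hμ A (eq_dirac_of_measureReal_singleton ?_)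
  refine le_measureReal_singleton fun η hη => le_of_forall_pos_sub_le fun e he => ?_
  refine le_measureReal_of_isClosed hνφ Metric.isClosed_closedBall (Eventually.frequently ?_)
  filter_upwards [hsub hA η hη, hsub hB η hη,
    hεφ.eventually (gt_mem_nhds (half_pos he)),
    hεφ.eventually (gt_mem_nhds (show (0 : ℝ) < 1 / 2 by norm_num))] with l h1 h2 h3 h4
  have hdisj : Disjoint (Metric.ball (a (φ l)) (ε (φ l) * (b (φ l) - a (φ l))))
      (Metric.ball (b (φ l)) (ε (φ l) * (b (φ l) - a (φ l)))) := by
    apply Metric.ball_disjoint_ball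
    rw [Real.dist_eq, abs_sub_comm, abs_of_pos (by linarith [hab (φ l)])]
    nlinarith [hab (φ l)]
  have h5 := measureReal_union (μ := (ν (φ l) : Measure ℝ)) hdisj Metric.isOpen_ball.measurableSet
  have h6 := measureReal_mono (μ := (ν (φ l) : Measure ℝ)) (Set.union_subset h1 h2)
  linarith [ha (φ l), hb (φ l)]


/-! ### The law of a negated exponential variable -/

/-- The law of `-E`, where `E` is exponential with rate `1`. It is a max-stable law. -/
def negExp : Measure ℝ := (ProbabilityTheory.expMeasure 1).map (fun x => -x)

instance isProbabilityMeasure_negExp : IsProbabilityMeasure negExp :=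
  have := ProbabilityTheory.isProbabilityMeasure_expMeasure one_pos
  Measure.isProbabilityMeasure_map measurable_neg.aemeasurable

instance nullSingletonClass_negExp : NullSingletonClass negExp := by
  refine ⟨fun x => ?_⟩
  rw [negExp, Measure.map_apply measurable_neg (measurableSet_singleton x),
    show (fun x : ℝ => -x) ⁻¹' {x} = {-x} by ext y; simp,
    ProbabilityTheory.expMeasure, ProbabilityTheory.gammaMeasure]
  exact (withDensity_absolutelyContinuous _ _) (measure_singleton _)

theorem measureReal_negExp_Iic (t : ℝ) : negExp.real (Set.Iic t) = Real.exp (min t 0) := by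
  have := ProbabilityTheory.isProbabilityMeasure_expMeasure one_pos
  have hcompl : (Set.Iic t)ᶜ = Set.Ioi t := Set.compl_Iic
  have h1 : negExp.real (Set.Ioi t) = negExp.real (Set.Ici t) :=
    measureReal_congr Ioi_ae_eq_Ici
  have h2 : negExp.real (Set.Ici t) =
      ProbabilityTheory.cdf (ProbabilityTheory.expMeasure 1) (-t) := by
    rw [ProbabilityTheory.cdf_eq_real, negExp,
      map_measureReal_apply measurable_neg measurableSet_Ici]
    congr 1
    ext y
    simp
  have h3 := probReal_compl_eq_one_sub (μ := negExp) (measurableSet_Iic (a := t))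
  rw [hcompl, h1, h2, ProbabilityTheory.cdf_expMeasure_eq one_pos] at h3
  split_ifs at h3 with h
  · rw [min_eq_left (by linarith)]
    simp only [one_mul, neg_neg] at h3
    linarith
  · rw [min_eq_right (by linarith), Real.exp_zero]
    linarith

theorem ae_negExp_neg : ∀ᵐ v ∂negExp, v < 0 := by
  have h : negExp.real (Set.Iic 0) = 1 := by simp [measureReal_negExp_Iic]
  have h1 : negExp (Set.Ioi 0) = 0 := by
    have := probReal_compl_eq_one_sub (μ := negExp) (measurableSet_Iic (a := (0 : ℝ)))
    rw [h, sub_self, Set.compl_Iic] at this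
    exact (measureReal_eq_zero_iff (measure_ne_top _ _)).1 this
  have h2 : negExp (Set.Ici 0) = 0 := by rw [← measure_congr Ioi_ae_eq_Ici, h1]
  have : ∀ᵐ v ∂negExp, v ∈ (Set.Ici (0 : ℝ))ᶜ := by
    exact (measure_eq_zero_iff_ae_notMem).1 h2
  filter_upwards [this] with v hv
  simpa using hv

/-- The maximum of `n + 1` real numbers. -/
def realMax (n : ℕ) (v : Fin (n + 1) → ℝ) : ℝ := Finset.univ.sup' Finset.univ_nonempty v

theorem measurable_realMax (n : ℕ) : Measurable (realMax n) := by
  have h : Measurable (Finset.univ.sup' Finset.univ_nonempty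
      (fun (i : Fin (n + 1)) (x : Fin (n + 1) → ℝ) => x i)) :=
    Finset.measurable_sup' _ fun i _ => by fun_prop
  convert h using 1
  ext x
  simp [realMax, Finset.sup'_apply]

/-- Max-stability: the `(n + 1)`-st power of `exp (min t 0)` is `exp (min ((n + 1) * t) 0)`. -/
theorem map_realMax_negExp (n : ℕ) :
    (Measure.pi fun _ : Fin (n + 1) => negExp).map (realMax n) =
      negExp.map (fun v : ℝ => v / ((n : ℝ) + 1)) := by
  have hm : Measurable (fun v : ℝ => v / ((n : ℝ) + 1)) := by fun_prop
  have := Measure.isProbabilityMeasure_map (μ := Measure.pi fun _ : Fin (n + 1) => negExp)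
    (measurable_realMax n).aemeasurable
  have := Measure.isProbabilityMeasure_map (μ := negExp) hm.aemeasurable
  have hn : (0 : ℝ) < n + 1 := by positivity
  refine Measure.ext_of_Iic _ _ fun t => ?_
  rw [Measure.map_apply (measurable_realMax n) measurableSet_Iic,
    Measure.map_apply hm measurableSet_Iic]
  have h1 : realMax n ⁻¹' Set.Iic t = Set.pi Set.univ fun _ => Set.Iic t := by
    ext v
    simp [realMax, Finset.sup'_le_iff, Pi.le_def]
  have h2 : (fun v : ℝ => v / ((n : ℝ) + 1)) ⁻¹' Set.Iic t = Set.Iic ((n + 1) * t) := by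
    ext v
    simp [div_le_iff₀ hn, mul_comm]
  rw [h1, h2, Measure.pi_pi, ← ENNReal.toReal_eq_toReal_iff' (by simp) (by simp)]
  simp only [Finset.prod_const, Finset.card_univ, Fintype.card_fin, ENNReal.toReal_pow]
  change (negExp.real _) ^ _ = negExp.real _
  rw [measureReal_negExp_Iic, measureReal_negExp_Iic, ← Real.exp_nat_mul]
  congr 1
  push_cast
  rw [← mul_zero ((n : ℝ) + 1), mul_min_of_nonneg _ _ hn.le, mul_zero, mul_zero]

/-! ### Splicing a prescribed upper tail into a law -/

variable {k : ℕ}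

/-- Truncate `x` from above at `m`, except for `v` close to `0`, when the point `ψ v` of the
diagonal is returned. -/
def splice (m : ℕ) (ψ : ℝ → ℝ) (x : (Fin k → ℝ) × ℝ) : Fin k → ℝ :=
  if x.2 ≤ -(1 / ((m : ℝ) + 1)) then fun j => min (x.1 j) m else fun _ => ψ x.2

theorem measurable_splice (m : ℕ) {ψ : ℝ → ℝ} (hψ : Measurable ψ) :
    Measurable (splice (k := k) m ψ) := by
  refine Measurable.ite (measurableSet_le measurable_snd measurable_const) ?_ ?_
  · exact measurable_pi_iff.2 fun j => by fun_prop
  · exact measurable_pi_iff.2 fun j => hψ.comp measurable_snd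

/-- The law of `splice m ψ (X, V)` for `X` with law `F` and an independent `V` with law `negExp`. -/
def spliceLaw (F : ProbabilityMeasure (Fin k → ℝ)) (m : ℕ) {ψ : ℝ → ℝ} (hψ : Measurable ψ) :
    ProbabilityMeasure (Fin k → ℝ) :=
  ⟨((F : Measure (Fin k → ℝ)).prod negExp).map (splice m ψ),
    Measure.isProbabilityMeasure_map (measurable_splice m hψ).aemeasurable⟩

/-- Almost surely `V < 0`, so for large `m` neither the splice nor the truncation acts and the
spliced point is `X` itself; dominated convergence concludes. -/
theorem tendsto_spliceLaw (F : ProbabilityMeasure (Fin k → ℝ)) {ψ : ℕ → ℝ → ℝ}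
    (hψ : ∀ m, Measurable (ψ m)) :
    Tendsto (fun m => spliceLaw F m (hψ m)) atTop (𝓝 F) := by
  rw [ProbabilityMeasure.tendsto_iff_forall_integral_tendsto]
  intro f
  have h1 : ∀ m, ∫ x, f x ∂(spliceLaw F m (hψ m) : Measure (Fin k → ℝ)) =
      ∫ y, f (splice m (ψ m) y) ∂((F : Measure (Fin k → ℝ)).prod negExp) := fun m =>
    integral_map (measurable_splice m (hψ m)).aemeasurable
      f.continuous.measurable.aestronglyMeasurable
  have h2 : ∫ x, f x ∂(F : Measure (Fin k → ℝ)) =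
      ∫ y, f y.1 ∂((F : Measure (Fin k → ℝ)).prod negExp) := by
    rw [integral_fun_fst (f := fun x => f x)]
    simp
  simp_rw [h1, h2]
  refine tendsto_integral_of_dominated_convergence (fun _ => ‖f‖) (fun m =>
    (f.continuous.measurable.comp (measurable_splice m (hψ m))).aestronglyMeasurable)
    (integrable_const _) (fun m => Eventually.of_forall fun y => f.norm_coe_le_norm _) ?_
  have h3 : ∀ᵐ y ∂((F : Measure (Fin k → ℝ)).prod negExp), y.2 < 0 :=
    Measure.quasiMeasurePreserving_snd.ae ae_negExp_neg
  filter_upwards [h3] with y hy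
  refine (f.continuous.tendsto _).comp (tendsto_const_nhds.congr' ?_)
  have h4 : ∀ᶠ m : ℕ in atTop, ∀ j, y.1 j ≤ m :=
    eventually_all.2 fun j => tendsto_natCast_atTop_atTop.eventually_ge_atTop _
  have h5 : Tendsto (fun m : ℕ => -(1 / ((m : ℝ) + 1))) atTop (𝓝 0) := by
    simpa using (tendsto_one_div_add_atTop_nhds_zero_nat (𝕜 := ℝ)).neg
  filter_upwards [h4, h5.eventually (lt_mem_nhds hy)] with m h6 h7
  rw [splice, if_pos h7.le]
  ext j
  rw [min_eq_left (h6 j)]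

/-- The index with the largest `V` contributes `ψ (max V)`. This dominates the truncated points,
which are at most `m`, and by monotonicity the other diagonal points. -/
theorem vecMax_splice (m n : ℕ) {ψ : ℝ → ℝ} (hψ : Monotone ψ)
    (hm : ∀ v, -(1 / ((m : ℝ) + 1)) < v → m ≤ ψ v) (x : Fin (n + 1) → (Fin k → ℝ) × ℝ)
    (hx : -(1 / ((m : ℝ) + 1)) < realMax n fun i => (x i).2) :
    vecMax n (fun i => splice m ψ (x i)) = fun _ => ψ (realMax n fun i => (x i).2) := by
  obtain ⟨i₀, -, hi₀⟩ := Finset.exists_mem_eq_sup' Finset.univ_nonempty fun i => (x i).2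
  refine le_antisymm (Finset.sup'_le _ _ fun i _ => ?_) ?_
  · have hle : (x i).2 ≤ realMax n fun i => (x i).2 :=
      Finset.le_sup' (fun i => (x i).2) (Finset.mem_univ i)
    intro j
    rw [splice]
    split_ifs with h
    · exact (min_le_right _ _).trans (hm _ hx)
    · exact hψ hle
  · refine le_trans (le_of_eq ?_)
      (Finset.le_sup' (fun i => splice m ψ (x i)) (Finset.mem_univ i₀))
    have h0 : realMax n (fun i => (x i).2) = (x i₀).2 := hi₀
    rw [h0] at hx ⊢
    rw [splice, if_neg (not_le.2 hx)]

theorem le_maxLaw_spliceLaw (F : ProbabilityMeasure (Fin k → ℝ)) (m n : ℕ) {ψ : ℝ → ℝ}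
    (hψ : Monotone ψ) (hm : ∀ v, -(1 / ((m : ℝ) + 1)) < v → m ≤ ψ v)
    {S : Set (Fin k → ℝ)} (hS : MeasurableSet S) :
    negExp {v | -((n + 1) / ((m : ℝ) + 1)) < v ∧ (fun _ => ψ (v / (n + 1))) ∈ S} ≤
      (maxLaw (spliceLaw F m hψ.measurable) n : Measure (Fin k → ℝ)) S := by
  have hsp := measurable_splice (k := k) m hψ.measurable
  have hconst : Measurable fun v : ℝ => (fun _ : Fin k => ψ v) :=
    measurable_pi_iff.2 fun _ => hψ.measurable
  set T : Set ℝ := {w | -(1 / ((m : ℝ) + 1)) < w ∧ (fun _ : Fin k => ψ w) ∈ S} with hT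
  have hTm : MeasurableSet T := measurableSet_Ioi.inter (hconst hS)
  have hn : (0 : ℝ) < n + 1 := by positivity
  have e1 : {v | -((n + 1) / ((m : ℝ) + 1)) < v ∧ (fun _ => ψ (v / (n + 1))) ∈ S} =
      (fun v : ℝ => v / ((n : ℝ) + 1)) ⁻¹' T := by
    ext v
    simp only [hT, Set.mem_ofPred_eq, Set.mem_preimage, lt_div_iff₀ hn]
    rw [show -(1 / ((m : ℝ) + 1)) * (n + 1) = -((n + 1) / ((m : ℝ) + 1)) by ring]
  -- Coupling: the `V`s and the spliced vectors are read off the same i.i.d. pairs, so that the two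
  -- events can be compared pointwise.
  have e2 : (Measure.pi fun _ : Fin (n + 1) => negExp) =
      (Measure.pi fun _ : Fin (n + 1) => (F : Measure (Fin k → ℝ)).prod negExp).map
        (fun x i => (x i).2) := by
    rw [Measure.pi_map_pi fun _ => measurable_snd.aemeasurable]
    simp [Measure.map_snd_prod]
  have e3 : (Measure.pi fun _ : Fin (n + 1) =>
        (spliceLaw F m hψ.measurable : Measure (Fin k → ℝ))) =
      (Measure.pi fun _ : Fin (n + 1) => (F : Measure (Fin k → ℝ)).prod negExp).map
        (fun x i => splice m ψ (x i)) := by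
    have := Measure.isProbabilityMeasure_map
      (μ := (F : Measure (Fin k → ℝ)).prod negExp) hsp.aemeasurable
    rw [Measure.pi_map_pi fun _ => hsp.aemeasurable]
    rfl
  have m1 : Measurable fun (x : Fin (n + 1) → (Fin k → ℝ) × ℝ) i => (x i).2 := by fun_prop
  have m2 : Measurable fun (x : Fin (n + 1) → (Fin k → ℝ) × ℝ) i => splice m ψ (x i) :=
    measurable_pi_iff.2 fun i => hsp.comp (measurable_pi_apply i)
  rw [e1, ← Measure.map_apply (by fun_prop) hTm, ← map_realMax_negExp, e2,
    Measure.map_map (measurable_realMax n) m1,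
    Measure.map_apply ((measurable_realMax n).comp m1) hTm, maxLaw,
    ProbabilityMeasure.toMeasure_map, ProbabilityMeasure.toMeasure_pi, e3,
    Measure.map_map (measurable_vecMax n) m2,
    Measure.map_apply ((measurable_vecMax n).comp m2) hS]
  refine measure_mono fun x hx => ?_
  simp only [Set.mem_preimage, Function.comp_apply, hT, Set.mem_ofPred_eq] at hx ⊢
  rw [vecMax_splice m n hψ hm x hx.1]
  exact hx.2


/-! ### Density of the domain of attraction -/

theorem measurable_diag : Measurable fun (v : ℝ) (_ : Fin k) => v :=
  measurable_pi_iff.2 fun _ => measurable_id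

/-- The law of `(V, …, V)` for `V` with law `negExp`. -/
def diagNegExp (k : ℕ) : ProbabilityMeasure (Fin k → ℝ) :=
  ⟨negExp.map fun v _ => v, Measure.isProbabilityMeasure_map measurable_diag.aemeasurable⟩

theorem nondegenerateMarginals_diagNegExp : NondegenerateMarginals (diagNegExp k) := by
  intro j c h
  have h1 : (diagNegExp k : Measure (Fin k → ℝ)).map (fun x => x j) = negExp := by
    change (negExp.map fun v _ => v).map (fun x : Fin k → ℝ => x j) = negExp
    rw [Measure.map_map (measurable_pi_apply j) measurable_diag]
    exact Measure.map_id
  rw [h1] at h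
  have h2 : negExp {c} = 1 := by simp [h]
  simp at h2

/-- The constraint `c n < v` disappears in the limit, by continuity from below. -/
theorem measure_le_liminf_of_tendsto_atBot {μ : Measure ℝ} {S : Set ℝ} {c : ℕ → ℝ}
    (hc : Tendsto c atTop atBot) {u : ℕ → ENNReal} (hu : ∀ n, μ ({v | c n < v} ∩ S) ≤ u n) :
    μ S ≤ liminf u atTop := by
  have hU : ⋃ N : ℕ, {v : ℝ | -(N : ℝ) < v} ∩ S = S := by
    rw [← Set.iUnion_inter, Set.inter_eq_right]
    intro v _
    obtain ⟨N, hN⟩ := exists_nat_gt (-v)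
    exact Set.mem_iUnion.2 ⟨N, by rw [Set.mem_ofPred_eq]; linarith⟩
  have ht : Tendsto (fun N : ℕ => μ ({v : ℝ | -(N : ℝ) < v} ∩ S)) atTop (𝓝 (μ S)) := by
    nth_rewrite 2 [← hU]
    refine tendsto_measure_iUnion_atTop fun M N hMN => Set.inter_subset_inter_left _ ?_
    intro v (hv : -(M : ℝ) < v)
    exact lt_of_le_of_lt (neg_le_neg (Nat.cast_le.2 hMN)) hv
  refine le_of_tendsto' ht fun N => le_liminf_of_le (by isBoundedDefault) ?_
  filter_upwards [hc.eventually_le_atBot (-(N : ℝ))] with n hn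
  exact (measure_mono (Set.inter_subset_inter_left _
    fun v (hv : -(N : ℝ) < v) => hn.trans_lt hv)).trans (hu n)

theorem tendsto_neg_add_one_div_atBot (m : ℕ) :
    Tendsto (fun n : ℕ => -(((n : ℝ) + 1) / ((m : ℝ) + 1))) atTop atBot :=
  tendsto_neg_atTop_atBot.comp ((tendsto_atTop_add_const_right _ 1
    tendsto_natCast_atTop_atTop).atTop_div_const (by positivity))

theorem monotone_add_add_one (m : ℕ) : Monotone fun v : ℝ => v + (m + 1) :=
  fun _ _ h => by dsimp only; gcongr

/-- The normalisation undoes `ψ` exactly: `(n + 1) * (V / (n + 1) + (m + 1)) - (n + 1) * (m + 1) =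
V`. Only the event that no `V` is near `0` causes an error, so lower bounds on open sets suffice. -/
theorem inDomainOfAttraction_spliceLaw (F : ProbabilityMeasure (Fin k → ℝ)) (m : ℕ) :
    InDomainOfAttraction (spliceLaw F m (monotone_add_add_one m).measurable) (diagNegExp k) := by
  refine ⟨nondegenerateMarginals_diagNegExp, fun n _ => n + 1, fun n _ => -((n + 1) * (m + 1)),
    fun n _ => by positivity, tendsto_of_forall_isOpen_le_liminf' fun O hO => ?_⟩
  have e1 : (diagNegExp k : Measure (Fin k → ℝ)) O = negExp {v | (fun _ : Fin k => v) ∈ O} :=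
    Measure.map_apply measurable_diag hO.measurableSet
  rw [e1]
  refine measure_le_liminf_of_tendsto_atBot (tendsto_neg_add_one_div_atBot m) fun n => ?_
  have hmeas := measurable_affineMap (k := k) (fun _ => (n : ℝ) + 1)
    (fun _ => -(((n : ℝ) + 1) * (m + 1)))
  rw [ProbabilityMeasure.toMeasure_map, Measure.map_apply hmeas hO.measurableSet]
  refine le_trans (measure_mono ?_) (le_maxLaw_spliceLaw F m n (monotone_add_add_one m) ?_
    (hmeas hO.measurableSet))
  · rintro v ⟨hv, hvO⟩
    refine ⟨hv, ?_⟩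
    have hn : (n : ℝ) + 1 ≠ 0 := by positivity
    have : affineMap (fun _ => (n : ℝ) + 1) (fun _ => -(((n : ℝ) + 1) * (m + 1)))
        (fun _ : Fin k => v / (n + 1) + (m + 1)) = fun _ => v := by
      ext j
      simp only [affineMap]
      field_simp
      ring
    rw [Set.mem_preimage, this]
    exact hvO
  · intro v hv
    -- The shift is `m + 1` because `v` may be as low as `-1 / (m + 1) ≥ -1`, while `ψ v ≥ m` is
    -- needed.
    have : 1 / ((m : ℝ) + 1) ≤ 1 := by
      rw [div_le_one (by positivity)]; linarith [(Nat.cast_nonneg m : (0 : ℝ) ≤ m)]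
    linarith

theorem dense_maxDomain (k : ℕ) : Dense (maxDomain k) := fun F =>
  mem_closure_of_tendsto (tendsto_spliceLaw F fun m => (monotone_add_add_one m).measurable)
    (Eventually.of_forall fun m => ⟨_, inDomainOfAttraction_spliceLaw F m⟩)

/-! ### The domain of attraction is meagre -/

/-- The law of the `j`-th component of `max {X₁, …, Xₙ₊₁}`. -/
def maxMarginal (F : ProbabilityMeasure (Fin k → ℝ)) (n : ℕ) (j : Fin k) : ProbabilityMeasure ℝ :=
  (maxLaw F n).map (measurable_pi_apply j).aemeasurable

theorem continuous_vecMax (n : ℕ) : Continuous (vecMax (k := k) n) := by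
  refine continuous_pi fun j => ?_
  have h : Continuous fun x : Fin (n + 1) → Fin k → ℝ =>
      Finset.univ.sup' Finset.univ_nonempty fun i => x i j :=
    Continuous.finset_sup'_apply _ fun i _ => by fun_prop
  convert h using 1
  ext x
  simp [vecMax, Finset.sup'_apply]

theorem continuous_maxMarginal (n : ℕ) (j : Fin k) :
    Continuous fun F : ProbabilityMeasure (Fin k → ℝ) => maxMarginal F n j := by
  have h1 : Continuous fun F : ProbabilityMeasure (Fin k → ℝ) =>
      ProbabilityMeasure.pi fun _ : Fin (n + 1) => F :=
    ProbabilityMeasure.continuous_pi.comp (continuous_pi fun _ => continuous_id)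
  exact (ProbabilityMeasure.continuous_map (continuous_apply j)).comp
    ((ProbabilityMeasure.continuous_map (continuous_vecMax n)).comp h1)

/-- The laws for which the `j`-th component of some late maximum is close to a two-point law. -/
def nearTwoPointSet (p : ℝ) (j : Fin k) (l : ℕ) : Set (ProbabilityMeasure (Fin k → ℝ)) :=
  {F | ∃ n ≥ l, IsNearTwoPoint p (1 / ((l : ℝ) + 1)) (maxMarginal F n j)}

theorem isOpen_nearTwoPointSet (p : ℝ) (j : Fin k) (l : ℕ) :
    IsOpen (nearTwoPointSet p j l) := by
  have : nearTwoPointSet p j l = ⋃ n ≥ l, (fun F => maxMarginal F n j) ⁻¹'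
      {ν | IsNearTwoPoint p (1 / ((l : ℝ) + 1)) ν} := by
    ext F
    simp [nearTwoPointSet]
  rw [this]
  exact isOpen_biUnion fun n _ =>
    (isOpen_setOf_isNearTwoPoint _ _).preimage (continuous_maxMarginal n j)

/-- The function that jumps from `m + 1` to `m + 2` at `t`. -/
def stepAt (m : ℕ) (t v : ℝ) : ℝ := if v ≤ t then m + 1 else m + 2

theorem monotone_stepAt (m : ℕ) (t : ℝ) : Monotone (stepAt m t) := by
  intro v w h
  unfold stepAt
  split_ifs <;> linarith

theorem le_stepAt (m : ℕ) (t v : ℝ) : m ≤ stepAt m t v := by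
  unfold stepAt
  split_ifs <;> linarith

theorem dense_nearTwoPointSet {p : ℝ} (hp0 : 0 < p) (hp1 : p < 1) (j : Fin k) (l : ℕ) :
    Dense (nearTwoPointSet p j l) := by
  intro F
  set ε : ℝ := 1 / ((l : ℝ) + 1) with hε
  have hε0 : 0 < ε := by positivity
  -- The `p`-quantile of `negExp`. A jump of `ψ` at `t / (n + 1)` splits the law of `V / (n + 1)`
  -- into masses `p` and `1 - p`.
  set t := Real.log p with ht
  have ht0 : t < 0 := Real.log_neg hp0 hp1
  have hIic : negExp.real (Set.Iic t) = p := by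
    rw [measureReal_negExp_Iic, min_eq_left ht0.le, Real.exp_log hp0]
  have hIoi : negExp.real (Set.Ioi t) = 1 - p := by
    rw [← Set.compl_Iic, probReal_compl_eq_one_sub measurableSet_Iic, hIic]
  have hlow : Tendsto (fun c => negExp.real (Set.Iic c)) atBot (𝓝 0) := by
    refine (Real.tendsto_exp_atBot).congr' ?_
    filter_upwards [eventually_le_atBot 0] with c hc
    rw [measureReal_negExp_Iic, min_eq_left hc]
  -- For each `m`, `n` is taken so late that with probability above `1 - ε` some `V` lies in the
  -- spliced range; the jump must lie there too.
  have hn : ∀ m : ℕ, ∃ n ≥ l, -(((n : ℝ) + 1) / ((m : ℝ) + 1)) < t ∧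
      negExp.real (Set.Iic (-(((n : ℝ) + 1) / ((m : ℝ) + 1)))) < ε := fun m =>
    ((eventually_ge_atTop l).and
      (((tendsto_neg_add_one_div_atBot m).eventually_lt_atBot t).and
        ((hlow.comp (tendsto_neg_add_one_div_atBot m)).eventually (gt_mem_nhds hε0)))).exists
  choose n hnl hnt hnε using hn
  refine mem_closure_of_tendsto (tendsto_spliceLaw F fun m =>
    (monotone_stepAt m (t / (n m + 1))).measurable) (Eventually.of_forall fun m => ?_)
  refine ⟨n m, hnl m, m + 1, m + 2, by linarith, ?_⟩
  rw [show (m : ℝ) + 2 - (m + 1) = 1 by ring, mul_one, ← hε]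
  have hn1 : (0 : ℝ) < n m + 1 := by positivity
  have key : ∀ (y : ℝ) (T : Set ℝ),
      (∀ v ∈ T, -((n m + 1) / ((m : ℝ) + 1)) < v ∧
        stepAt m (t / (n m + 1)) (v / (n m + 1)) = y) →
      negExp.real T ≤ (maxMarginal (spliceLaw F m
        (monotone_stepAt m (t / (n m + 1))).measurable) (n m) j : Measure ℝ).real
          (Metric.ball y ε) := by
    intro y T hT
    have hmeas : MeasurableSet ((fun x : Fin k → ℝ => x j) ⁻¹' Metric.ball y ε) :=
      measurable_pi_apply j Metric.isOpen_ball.measurableSet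
    refine ENNReal.toReal_mono (measure_ne_top _ _) ?_
    rw [maxMarginal, ProbabilityMeasure.toMeasure_map,
      Measure.map_apply (measurable_pi_apply j) Metric.isOpen_ball.measurableSet]
    refine le_trans (measure_mono fun v hv => ?_) (le_maxLaw_spliceLaw F m (n m)
      (monotone_stepAt m (t / (n m + 1))) (fun v _ => le_stepAt m _ v) hmeas)
    refine ⟨(hT v hv).1, ?_⟩
    simp only [Set.mem_preimage, (hT v hv).2]
    exact Metric.mem_ball_self hε0
  constructor
  · refine lt_of_lt_of_le ?_ (key _ (Set.Ioc (-((n m + 1) / ((m : ℝ) + 1))) t) fun v hv =>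
      ⟨hv.1, if_pos (by gcongr; exact hv.2)⟩)
    rw [← Set.Iic_sdiff_Iic, measureReal_sdiff (Set.Iic_subset_Iic.2 (hnt m).le) measurableSet_Iic,
      hIic]
    linarith [hnε m]
  · refine lt_of_lt_of_le ?_ (key _ (Set.Ioi t) fun v hv =>
      ⟨(hnt m).trans hv, if_neg (not_le.2 (by gcongr; exact hv))⟩)
    rw [hIoi]
    linarith

theorem exists_atoms_of_inDomainOfAttraction {F G : ProbabilityMeasure (Fin k → ℝ)}
    (h : InDomainOfAttraction F G) (j : Fin k) {p : ℝ} (hp0 : 0 < p) (hp1 : p < 1)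
    (hF : ∀ l, F ∈ nearTwoPointSet p j l) :
    ∃ A B : ℝ, A < B ∧ p ≤ ((G : Measure (Fin k → ℝ)).map fun x => x j).real {A} ∧
      1 - p ≤ ((G : Measure (Fin k → ℝ)).map fun x => x j).real {B} := by
  obtain ⟨hG, α, β, hα, hlim⟩ := h
  choose n hnl hn using hF
  have hntop : Tendsto n atTop atTop := tendsto_atTop_mono hnl tendsto_id
  have hlim' := ((ProbabilityMeasure.continuous_map
    (continuous_apply (A := fun _ : Fin k => ℝ) j)).tendsto G).comp (hlim.comp hntop)
  refine exists_atoms_of_tendsto hlim' (hG j) hp0 hp1 tendsto_one_div_add_atTop_nhds_zero_nat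
    fun l => ?_
  have hm : Measurable fun x : ℝ => α (n l) j * x + β (n l) j := by fun_prop
  convert (hn l).map_affine (hα (n l) j) (β (n l) j) hm.aemeasurable using 1
  apply Subtype.ext
  change (Measure.map _ (Measure.map _ _)) = Measure.map _ (Measure.map _ _)
  rw [Measure.map_map (measurable_pi_apply j) (measurable_affineMap _ _),
    Measure.map_map hm (measurable_pi_apply j)]
  rfl

/-- The atoms at `A` and `B` exhaust the mass, so the other pair is the same one in the same order.
Then `A` and `B` would carry at least `p + (1 - q) > 1`. -/
theorem not_atoms_of_weights {μ : Measure ℝ} [IsProbabilityMeasure μ] {p q A B A' B' : ℝ}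
    (hAB : A < B) (hAB' : A' < B') (hq : 0 < q) (hqp : q < p) (hp : p < 1)
    (hA : p ≤ μ.real {A}) (hB : 1 - p ≤ μ.real {B}) (hA' : q ≤ μ.real {A'})
    (hB' : 1 - q ≤ μ.real {B'}) : False := by
  have hmem : ∀ c, 0 < μ.real {c} → c = A ∨ c = B := by
    intro c hc
    by_contra! hne
    have h1 : μ.real ({A} ∪ {B}) = μ.real {A} + μ.real {B} :=
      measureReal_union (by simpa using hAB.ne) (measurableSet_singleton B)
    have h2 : μ.real (({A} ∪ {B}) ∪ {c}) = μ.real ({A} ∪ {B}) + μ.real {c} :=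
      measureReal_union (by simp [hne.1, hne.2]) (measurableSet_singleton c)
    have h3 : μ.real (({A} ∪ {B}) ∪ {c}) ≤ 1 := measureReal_le_one
    linarith
  have hBB : B' = B := by
    rcases hmem A' (by linarith) with h | h <;> rcases hmem B' (by linarith) with h' | h'
    · linarith
    · exact h'
    · linarith
    · exact h'
  subst hBB
  have h1 : μ.real ({A} ∪ {B'}) = μ.real {A} + μ.real {B'} :=
    measureReal_union (by simpa using hAB.ne) (measurableSet_singleton B')
  have h2 : μ.real ({A} ∪ {B'}) ≤ 1 := measureReal_le_one
  linarith

/-- A coordinate is needed: for `k = 0` nondegeneracy is vacuous and the domain is the whole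
one-point space. -/
theorem isMeagre_maxDomain (j : Fin k) : IsMeagre (maxDomain k) := by
  have hres : ∀ p : ℝ, 0 < p → p < 1 → (⋂ l, nearTwoPointSet p j l) ∈ residual _ :=
    fun p hp0 hp1 => countable_iInter_mem.2 fun l =>
      residual_of_dense_open (isOpen_nearTwoPointSet p j l) (dense_nearTwoPointSet hp0 hp1 j l)
  refine mem_of_superset (inter_mem (hres (1 / 2) (by norm_num) (by norm_num))
    (hres (1 / 3) (by norm_num) (by norm_num))) ?_
  rintro F ⟨h2, h3⟩ ⟨G, hG⟩
  obtain ⟨A, B, hAB, hA, hB⟩ := exists_atoms_of_inDomainOfAttraction hG j (by norm_num)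
    (by norm_num) (Set.mem_iInter.1 h2)
  obtain ⟨A', B', hAB', hA', hB'⟩ := exists_atoms_of_inDomainOfAttraction hG j (by norm_num)
    (by norm_num) (Set.mem_iInter.1 h3)
  have := Measure.isProbabilityMeasure_map (μ := (G : Measure (Fin k → ℝ)))
    (measurable_pi_apply j).aemeasurable
  exact not_atoms_of_weights hAB hAB' (by norm_num) (by norm_num) (by norm_num) hA hB hA' hB'

end ExtremeValue

end

theorem theorem1p2 (k : ℕ) (hk : 1 ≤ k) :
    Dense (ExtremeValue.maxDomain k) ∧ IsMeagre (ExtremeValue.maxDomain k) :=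
  ⟨ExtremeValue.dense_maxDomain k, ExtremeValue.isMeagre_maxDomain ⟨0, hk⟩⟩
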